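/- Fix an integer $r\ge 0$. An $r$-graph is an $r$-uniform hypergraph on a finite vertex set; for a set $D$ of vertices of an $r$-graph $G$, $G[D]$ denotes the subgraph of $G$ induced on $D$. For $0<p<1$ let $G(n,p)$ be the random $r$-graph on the vertex set $\{1,\dots,n\}$ in which each $r$-subset is an edge with probability $p$, independently. Let $\mathcal F$ be any (possibly empty or infinite) collection of $r$-graphs, closed under isomorphism. The number of induced subgraphs of $G$ lying in $\mathcal F$ is the number of vertex sets $D$ with $G[D]\in\mathcal F$. For $n\ge r$ define $c_n\in[0,\infty]$ by $$\Pr[G(n,p)\text{ has no induced subgraph lying in }\mathcal F]=2^{-c_n\binom nr},$$ with the convention $2^{-\infty}=0$. **Theorem (hereditary supersaturation).** The limit $c=c(p,\mathcal F)=\lim_{n\to\infty}c_n\in[0,\infty]$ exists. Moreover, for every $\varepsilon>0$ there are $n_0$ and $\delta>0$, depending only on $\varepsilon$, $p$ and $\mathcal F$, such that for every integer $t\ge 0$ for which each member of $\mathcal F$ has at least $t$ vertices, and for every $n>n_0$, the following hold. 1. If $\mathcal A$ is a collection of $r$-graphs on the vertex set $\{1,\dots,n\}$ with $\Pr[G(n,p)\in\mathcal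 A]>2^{(-c+\varepsilon)\binom nr}$, then some graph in $\mathcal A$ contains at least $\delta n^t$ induced subgraphs lying in $\mathcal F$. 2. In particular, the probability that $G(n,p)$ contains fewer than $\delta n^t$ induced subgraphs lying in $\mathcal F$ is at most $2^{(-c+\varepsilon)\binom nr}$. (If $c=\infty$, then $2^{(-c+\varepsilon)\binom nr}$ is read as $0$ for $n\ge r$.) -/

import Mathlib

open Filter Topology MeasureTheory ProbabilityTheory
open scoped ENNReal

noncomputable section

/-- An `r`-uniform hypergraph with vertex set (the whole of) `V`, given by its set of edges,
which are `r`-element subsets of `V`. -/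
abbrev RGraph (r : ℕ) (V : Type*) : Type _ := Set {e : Finset V // e.card = r}

namespace RGraph

variable {r : ℕ} {V W : Type*}

/-- Pull back an `r`-graph along an injection `f` of vertex sets:
`e` is an edge of the pullback iff `f(e)` is an edge of `G`. -/
def comap (f : W ↪ V) (G : RGraph r V) : RGraph r W :=
  {e | (⟨e.1.map f, by rw [Finset.card_map, e.2]⟩ : {e : Finset V // e.card = r}) ∈ G}

/-- The induced subgraph `G[D]`, whose vertex set is `D`. -/
def induce (G : RGraph r V) (D : Finset V) : RGraph r D :=
  G.comap (Function.Embedding.subtype (· ∈ D))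

/-- Isomorphism of `r`-graphs. -/
def Isomorphic (G : RGraph r V) (H : RGraph r W) : Prop :=
  ∃ σ : V ≃ W, H.comap σ.toEmbedding = G

end RGraph

/-- A collection of finite `r`-graphs (up to isomorphism, the vertex sets are
`Fin k = {0, …, k - 1}`). The number of vertices of a member `F` is `F.1`. -/
abbrev RGraphFamily (r : ℕ) : Type := Set (Σ k : ℕ, RGraph r (Fin k))

namespace RGraphFamily

variable {r : ℕ} {V : Type*}

/-- `G` lies in the collection `𝓕`, that is, `G` is isomorphic to a member of `𝓕`. -/
def Contains (𝓕 : RGraphFamily r) (G : RGraph r V) : Prop :=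
  ∃ F ∈ 𝓕, RGraph.Isomorphic F.2 G

/-- The number of induced subgraphs of `G` that lie in `𝓕`, that is, the number of vertex
subsets `D` such that `G[D]` lies in `𝓕`. -/
def inducedCount (𝓕 : RGraphFamily r) {n : ℕ} (G : RGraph r (Fin n)) : ℕ :=
  {D : Finset (Fin n) | 𝓕.Contains (G.induce D)}.ncard

/-- The set of the `r`-graphs on `n` vertices that have no induced subgraph lying in `𝓕`. -/
def forb (𝓕 : RGraphFamily r) (n : ℕ) : Set (RGraph r (Fin n)) :=
  {G | ∀ D : Finset (Fin n), ¬ 𝓕.Contains (G.induce D)}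

end RGraphFamily

/-- The law of the random `r`-graph `G(n,p)`: each of the `r`-subsets of the vertex set is an
edge with probability `p`, independently of the others. -/
def gnp (r n : ℕ) (p : unitInterval) : Measure (RGraph r (Fin n)) :=
  setBernoulli Set.univ p

/-- `2 ^ x` for an extended real `x`, with `2 ^ (-∞) = 0` and `2 ^ ∞ = ∞`. -/
def twoPow (x : EReal) : ℝ≥0∞ := EReal.exp (x * (Real.log 2 : ℝ))

/-- The number `c_n` with `Pr[G(n,p) has no induced subgraph in 𝓕] = 2 ^ (-c_n * (n choose r))`
for `n ≥ r`; it is `∞` if this probability is `0`. -/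
def hereditaryExponent {r : ℕ} (p : unitInterval) (𝓕 : RGraphFamily r) (n : ℕ) : EReal :=
  -(ENNReal.log (gnp r n p (𝓕.forb n)) / (Real.log 2 : ℝ)) / (n.choose r : ℕ)

/-- The limit `c(p, 𝓕)` of `c_n` as `n → ∞`. -/
def limitExponent {r : ℕ} (p : unitInterval) (𝓕 : RGraphFamily r) : EReal :=
  limUnder atTop (hereditaryExponent p 𝓕)

theorem twoPow_coe (x : ℝ) : twoPow (x : EReal) = ENNReal.ofReal ((2 : ℝ) ^ x) := by
  rw [twoPow, ← EReal.coe_mul, EReal.exp_coe, Real.rpow_def_of_pos (by norm_num), mul_comm]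

theorem twoPow_bot : twoPow ⊥ = 0 := by
  rw [twoPow, EReal.bot_mul_coe_of_pos (Real.log_pos (by norm_num)), EReal.exp_bot]

/-- The defining property of `c_n`. -/
theorem gnp_forb_eq_twoPow {r n : ℕ} (p : unitInterval) (𝓕 : RGraphFamily r) (h : r ≤ n) :
    gnp r n p (𝓕.forb n) =
      twoPow (-hereditaryExponent p 𝓕 n * ((n.choose r : ℕ) : EReal)) := by
  have hc : ((n.choose r : ℕ) : EReal) ≠ 0 := by
    exact_mod_cast (Nat.choose_pos h).ne'
  have hl : ((Real.log 2 : ℝ) : EReal) ≠ 0 := by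
    exact_mod_cast (Real.log_pos (by norm_num : (1 : ℝ) < 2)).ne'
  have hct : ((n.choose r : ℕ) : EReal) ≠ ⊤ := EReal.natCast_ne_top _
  have hcb : ((n.choose r : ℕ) : EReal) ≠ ⊥ := EReal.natCast_ne_bot _
  have hlt : ((Real.log 2 : ℝ) : EReal) ≠ ⊤ := EReal.coe_ne_top _
  have hlb : ((Real.log 2 : ℝ) : EReal) ≠ ⊥ := EReal.coe_ne_bot _
  rw [twoPow, hereditaryExponent, EReal.neg_mul, EReal.div_mul_cancel hcb hct hc, neg_neg,
    EReal.div_mul_cancel hlb hlt hl, ENNReal.exp_log]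

end

/-! Write `P_m` for the probability that `G(m,p)` is `𝓕`-free, and `x = (n choose r) / (m choose
r)`. Every `r`-set lies in the same number of `m`-sets, so the `m`-sets with equal weights form a
fractional partition of the `r`-sets. Finner's inequality then treats freeness on the various
`m`-sets as if it came from `x` independent events, giving `P_n ≤ P_m ^ x`. So `c_n` is
nondecreasing for `n ≥ r` and converges.

The same inequality is robust (`gnp_mul_rpow_le`): giving each non-free `m`-set the value `lam`
instead of `0` yields `Pr[A] * lam ^ (η x) ≤ (P_m + lam) ^ x` when at most a proportion `η` of the
`m`-sets is bad. For finite `c`, fix `m` with `c_m` close to `c`, then `lam` small, then `η` small.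
For `c = ∞`, some `m` admits no free graph at all, so every `m`-set is bad.

Double counting (`card_badSets_mul_pow_le`) closes the argument: a member of `𝓕` on at least `t`
vertices spoils only `O(n ^ (-t))` of the `m`-sets, so few induced copies mean few bad sets. -/

/-! ### Finner's inequality. -/

/-- Finner's inequality (a generalised Hölder inequality) for partial integrals over a product of
probability spaces: `g i` depends only on the coordinates in `S i`, and the weights `w` form a
fractional partition of each integrated coordinate. -/
theorem lmarginal_prod_rpow_le {δ ι : Type*} [DecidableEq δ] {X : δ → Type*}
    [∀ e, MeasurableSpace (X e)] (μ : ∀ e, Measure (X e)) [∀ e, IsProbabilityMeasure (μ e)]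
    (I : Finset ι) (S : ι → Finset δ) (w : ι → ℝ) (hw : ∀ i, 0 ≤ w i)
    (g : ι → (∀ e, X e) → ℝ≥0∞) (hg : ∀ i, Measurable (g i))
    (hdep : ∀ i x y, (∀ e ∈ S i, x e = y e) → g i x = g i y) (T : Finset δ)
    (hT : ∀ e ∈ T, ∑ i ∈ I with e ∈ S i, w i = 1) (x : ∀ e, X e) :
    (∫⋯∫⁻_T, (fun x ↦ ∏ i ∈ I, g i x ^ w i) ∂μ) x ≤
      ∏ i ∈ I, (∫⋯∫⁻_T, g i ∂μ) x ^ w i := by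
  induction T using Finset.induction_on generalizing x with
  | empty => simp
  | insert e T he ih =>
    have hmeas : Measurable fun x ↦ ∏ i ∈ I, g i x ^ w i :=
      Finset.measurable_prod _ fun i _ ↦ (hg i).pow_const _
    -- Factors that ignore the coordinate `e` leave the integral over it; the weights of the others
    -- sum to 1, so Hölder applies to them.
    have hconst : ∀ i, e ∉ S i → ∀ a,
        (∫⋯∫⁻_T, g i ∂μ) (Function.update x e a) = (∫⋯∫⁻_T, g i ∂μ) x := by
      intro i hi a
      refine lintegral_congr fun y ↦ hdep i _ _ fun e' he' ↦ ?_
      have : e' ≠ e := fun h ↦ hi (h ▸ he')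
      simp [Function.updateFinset, this]
    have hmi : ∀ i, Measurable fun a ↦ (∫⋯∫⁻_T, g i ∂μ) (Function.update x e a) := fun i ↦
      ((hg i).lmarginal μ).comp (measurable_update x)
    rw [lmarginal_insert _ hmeas he]
    calc ∫⁻ a, (∫⋯∫⁻_T, (fun x ↦ ∏ i ∈ I, g i x ^ w i) ∂μ) (Function.update x e a) ∂μ e
        ≤ ∫⁻ a, ∏ i ∈ I, (∫⋯∫⁻_T, g i ∂μ) (Function.update x e a) ^ w i ∂μ e :=
          lintegral_mono fun a ↦ ih (fun e' h ↦ hT e' (Finset.mem_insert_of_mem h)) _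
      _ = ∫⁻ a, (∏ i ∈ I with e ∈ S i, (∫⋯∫⁻_T, g i ∂μ) (Function.update x e a) ^ w i) *
            ∏ i ∈ I with e ∉ S i, (∫⋯∫⁻_T, g i ∂μ) x ^ w i ∂μ e := by
          refine lintegral_congr fun a ↦ ?_
          rw [← Finset.prod_filter_mul_prod_filter_not I (fun i ↦ e ∈ S i)]
          congr 1
          refine Finset.prod_congr rfl fun i hi ↦ ?_
          rw [hconst i (Finset.mem_filter.1 hi).2]
      _ = (∫⁻ a, ∏ i ∈ I with e ∈ S i, (∫⋯∫⁻_T, g i ∂μ) (Function.update x e a) ^ w i ∂μ e) *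
            ∏ i ∈ I with e ∉ S i, (∫⋯∫⁻_T, g i ∂μ) x ^ w i :=
          lintegral_mul_const _ (Finset.measurable_prod _ fun i _ ↦ (hmi i).pow_const _)
      _ ≤ (∏ i ∈ I with e ∈ S i,
              (∫⁻ a, (∫⋯∫⁻_T, g i ∂μ) (Function.update x e a) ∂μ e) ^ w i) *
            ∏ i ∈ I with e ∉ S i, (∫⋯∫⁻_T, g i ∂μ) x ^ w i := by
          gcongr
          exact ENNReal.lintegral_prod_norm_pow_le _ (fun i _ ↦ (hmi i).aemeasurable)
            (hT e (Finset.mem_insert_self _ _)) fun i _ ↦ hw i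
      _ = ∏ i ∈ I, (∫⋯∫⁻_insert e T, g i ∂μ) x ^ w i := by
          rw [← Finset.prod_filter_mul_prod_filter_not I (fun i ↦ e ∈ S i)
            (fun i ↦ (∫⋯∫⁻_insert e T, g i ∂μ) x ^ w i)]
          congr 1
          · exact Finset.prod_congr rfl fun i _ ↦ by rw [lmarginal_insert _ (hg i) he]
          · refine Finset.prod_congr rfl fun i hi ↦ ?_
            rw [lmarginal_insert _ (hg i) he]
            simp [hconst i (Finset.mem_filter.1 hi).2]

/-- Finner's inequality over a finite product of probability spaces. -/
theorem lintegral_pi_prod_rpow_le {δ ι : Type*} [Fintype δ] [DecidableEq δ] {X : δ → Type*}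
    [∀ e, MeasurableSpace (X e)] (μ : ∀ e, Measure (X e)) [∀ e, IsProbabilityMeasure (μ e)]
    (I : Finset ι) (S : ι → Finset δ) (w : ι → ℝ) (hw : ∀ i, 0 ≤ w i)
    (g : ι → (∀ e, X e) → ℝ≥0∞) (hg : ∀ i, Measurable (g i))
    (hdep : ∀ i x y, (∀ e ∈ S i, x e = y e) → g i x = g i y)
    (hS : ∀ e, ∑ i ∈ I with e ∈ S i, w i = 1) :
    ∫⁻ x, ∏ i ∈ I, g i x ^ w i ∂Measure.pi μ ≤
      ∏ i ∈ I, (∫⁻ x, g i x ∂Measure.pi μ) ^ w i := by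
  have : ∀ e, Nonempty (X e) := fun e ↦ (inferInstance : (ae (μ e)).NeBot).nonempty
  let x : ∀ e, X e := fun e ↦ Classical.arbitrary _
  simp only [lintegral_eq_lmarginal_univ x]
  exact lmarginal_prod_rpow_le μ I S w hw g hg hdep Finset.univ (fun e _ ↦ hS e) x

/-- Finner's inequality for a Bernoulli random subset of a finite type. -/
theorem lintegral_setBernoulli_prod_rpow_le {δ ι : Type*} [Fintype δ] [DecidableEq δ]
    (p : unitInterval) (I : Finset ι) (S : ι → Finset δ) (w : ι → ℝ) (hw : ∀ i, 0 ≤ w i)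
    (g : ι → Set δ → ℝ≥0∞) (hdep : ∀ i x y, (∀ e ∈ S i, e ∈ x ↔ e ∈ y) → g i x = g i y)
    (hS : ∀ e, ∑ i ∈ I with e ∈ S i, w i = 1) :
    ∫⁻ x, ∏ i ∈ I, g i x ^ w i ∂setBernoulli Set.univ p ≤
      ∏ i ∈ I, (∫⁻ x, g i x ∂setBernoulli Set.univ p) ^ w i := by
  have hd : ∀ f : Set δ → ℝ≥0∞, Measurable f := fun f ↦ .of_discrete
  have hm : Measurable fun x : δ → Prop ↦ {i | x i} := measurable_setOfPred
  simp only [setBernoulli_eq_map, Measure.infinitePi_eq_pi, lintegral_map (hd _) hm]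
  exact lintegral_pi_prod_rpow_le _ I S w hw (fun i x ↦ g i {e | x e})
    (fun i ↦ (hd _).comp hm) (fun i x y h ↦ hdep i _ _ fun e he ↦ by simp [h e he]) hS

/-! ### Restriction and relabelling of random `r`-graphs. -/

/-- The preimage of a Bernoulli random set under an injective map is Bernoulli. -/
theorem setBernoulli_map_preimage {δ ε : Type*} (p : unitInterval) (φ : ε → δ)
    (hφ : Function.Injective φ) :
    (setBernoulli (Set.univ : Set δ) p).map (fun s ↦ φ ⁻¹' s) =
      setBernoulli (Set.univ : Set ε) p := by
  have hp : Measurable fun s : Set δ ↦ φ ⁻¹' s := measurable_set_iff.2 fun _ ↦ measurable_set_mem _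
  rw [setBernoulli_eq_map, setBernoulli_eq_map, Measure.map_map hp measurable_setOfPred]
  simp only [Set.mem_univ]
  have h := Measure.map_infinitePi_infinitePi_of_inj (P := fun _ : δ ↦
    unitInterval.toNNReal p • Measure.dirac True +
      unitInterval.toNNReal (unitInterval.symm p) • Measure.dirac False) hφ
  rw [← h, Measure.map_map measurable_setOfPred (by fun_prop)]
  rfl

namespace RGraph

variable {r : ℕ} {U V W : Type*}

theorem comap_comap (f : W ↪ V) (g : U ↪ W) (G : RGraph r V) :
    (G.comap f).comap g = G.comap (g.trans f) := by
  ext e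
  simp [comap, Finset.map_map]

/-- The map induced by an injection of vertex sets on the `r`-subsets. -/
def edgeMap (r : ℕ) (f : W ↪ V) (e : {e : Finset W // e.card = r}) :
    {e : Finset V // e.card = r} :=
  ⟨e.1.map f, by rw [Finset.card_map, e.2]⟩

theorem edgeMap_injective (f : W ↪ V) : Function.Injective (edgeMap r f) := fun _ _ h ↦
  Subtype.ext (Finset.map_injective f (congrArg Subtype.val h))

theorem induce_comap (f : W ↪ V) (G : RGraph r V) (D : Finset W) :
    ∃ σ : D ≃ D.map f, (G.comap f).induce D = (G.induce (D.map f)).comap σ.toEmbedding := by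
  refine ⟨Equiv.ofBijective (fun v ↦ ⟨f v, Finset.mem_map_of_mem f v.2⟩)
    ⟨fun u v h ↦ Subtype.ext (f.injective (congrArg Subtype.val h)), fun ⟨v, hv⟩ ↦ ?_⟩, ?_⟩
  · obtain ⟨u, hu, rfl⟩ := Finset.mem_map.1 hv
    exact ⟨⟨u, hu⟩, rfl⟩
  · rw [induce, induce, comap_comap, comap_comap]
    congr 1

end RGraph

theorem gnp_map_comap {r m n : ℕ} (p : unitInterval) (f : Fin m ↪ Fin n) :
    (gnp r n p).map (RGraph.comap f) = gnp r m p :=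
  setBernoulli_map_preimage p (RGraph.edgeMap r f) (RGraph.edgeMap_injective f)

namespace RGraphFamily

variable {r : ℕ} {V W : Type*} (𝓕 : RGraphFamily r)

theorem contains_comap_equiv (σ : V ≃ W) (G : RGraph r W) :
    𝓕.Contains (G.comap σ.toEmbedding) ↔ 𝓕.Contains G := by
  constructor
  · rintro ⟨F, hF, τ, hτ⟩
    exact ⟨F, hF, τ.trans σ, by rw [← hτ, RGraph.comap_comap]; rfl⟩
  · rintro ⟨F, hF, τ, hτ⟩
    refine ⟨F, hF, τ.trans σ.symm, ?_⟩
    rw [← hτ, RGraph.comap_comap]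
    congr 1
    ext
    simp

/-- No vertex subset of `S` induces a subgraph of `G` lying in `𝓕`. -/
def IsFreeOn (G : RGraph r V) (S : Finset V) : Prop :=
  ∀ D ⊆ S, ¬ 𝓕.Contains (G.induce D)

theorem isFreeOn_map_univ_iff {m n : ℕ} (f : Fin m ↪ Fin n) (G : RGraph r (Fin n)) :
    𝓕.IsFreeOn G (Finset.univ.map f) ↔ G.comap f ∈ 𝓕.forb m := by
  have key : ∀ D : Finset (Fin m),
      𝓕.Contains ((G.comap f).induce D) ↔ 𝓕.Contains (G.induce (D.map f)) := fun D ↦ by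
    obtain ⟨σ, hσ⟩ := RGraph.induce_comap f G D
    rw [hσ, contains_comap_equiv]
  constructor
  · intro h D hD
    exact h _ (Finset.map_subset_map.2 (Finset.subset_univ D)) ((key D).1 hD)
  · intro h D hD hc
    obtain ⟨D, -, rfl⟩ := Finset.subset_map_iff.1 hD
    exact h D ((key D).2 hc)

/-- Supplies the locality that Finner's inequality requires: freeness on `S` is decided by the edges
inside `S`. -/
theorem isFreeOn_congr {G H : RGraph r V} {S : Finset V}
    (h : ∀ e : {e : Finset V // e.card = r}, e.1 ⊆ S → (e ∈ G ↔ e ∈ H)) :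
    𝓕.IsFreeOn G S ↔ 𝓕.IsFreeOn H S := by
  refine forall₂_congr fun D hD ↦ ?_
  have : G.induce D = H.induce D := by
    ext e
    exact h _ fun v hv ↦ hD (by
      obtain ⟨u, -, rfl⟩ := Finset.mem_map.1 hv
      exact u.2)
  rw [this]

theorem isFreeOn_univ_iff {n : ℕ} {G : RGraph r (Fin n)} :
    𝓕.IsFreeOn G Finset.univ ↔ G ∈ 𝓕.forb n :=
  ⟨fun h D ↦ h D (Finset.subset_univ D), fun h D _ ↦ h D⟩

theorem IsFreeOn.mono {G : RGraph r V} {S T : Finset V} (h : 𝓕.IsFreeOn G T) (hST : S ⊆ T) :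
    𝓕.IsFreeOn G S := fun D hD ↦ h D (hD.trans hST)

/-- The vertex subsets of size `m` on which `G` is not `𝓕`-free. -/
noncomputable def badSets {n : ℕ} (G : RGraph r (Fin n)) (m : ℕ) : Finset (Finset (Fin n)) :=
  open Classical in {S ∈ Finset.univ.powersetCard m | ¬ 𝓕.IsFreeOn G S}

theorem badSets_eq_empty {m n : ℕ} {G : RGraph r (Fin n)} (hG : G ∈ 𝓕.forb n) :
    𝓕.badSets G m = ∅ := by
  classical
  exact Finset.filter_false_of_mem fun S _ ↦ not_not.2
    ((𝓕.isFreeOn_univ_iff.2 hG).mono 𝓕 (Finset.subset_univ S))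

end RGraphFamily

/-! ### Finner's inequality over the `m`-sets. -/

instance (r n : ℕ) (p : unitInterval) : IsProbabilityMeasure (gnp r n p) :=
  inferInstanceAs (IsProbabilityMeasure (setBernoulli _ p))

theorem exists_embedding_map_univ_eq {m n : ℕ} {S : Finset (Fin n)} (hS : S.card = m) :
    ∃ f : Fin m ↪ Fin n, Finset.univ.map f = S :=
  ⟨(S.orderEmbOfFin hS).toEmbedding, S.map_orderEmbOfFin_univ hS⟩

open Classical in
theorem lintegral_isFreeOn_le {r m n : ℕ} (p : unitInterval) (𝓕 : RGraphFamily r)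
    {S : Finset (Fin n)} (hS : S.card = m) (lam : ℝ≥0∞) :
    ∫⁻ G, (if 𝓕.IsFreeOn G S then 1 else lam) ∂gnp r n p ≤ gnp r m p (𝓕.forb m) + lam := by
  obtain ⟨f, rfl⟩ := exists_embedding_map_univ_eq hS
  simp only [RGraphFamily.isFreeOn_map_univ_iff]
  rw [← lintegral_map (μ := gnp r n p) (g := RGraph.comap f)
    (f := fun H ↦ if H ∈ 𝓕.forb m then 1 else lam) .of_discrete .of_discrete, gnp_map_comap]
  calc ∫⁻ H, (if H ∈ 𝓕.forb m then 1 else lam) ∂gnp r m p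
      ≤ ∫⁻ H, (𝓕.forb m).indicator 1 H + lam ∂gnp r m p := by
        refine lintegral_mono fun H ↦ ?_
        by_cases h : H ∈ 𝓕.forb m <;> simp [h]
    _ = gnp r m p (𝓕.forb m) + lam := by
        rw [lintegral_add_right _ measurable_const, lintegral_indicator_one .of_discrete]
        simp

/-- If every graph in `A` is `𝓕`-free on all but a proportion `η` of the `m`-sets, then `A` is
about as unlikely as being `𝓕`-free on each of `(n choose r) / (m choose r)` independent
`m`-sets. -/
theorem gnp_mul_rpow_le {r m n : ℕ} (hrm : r ≤ m) (hmn : m ≤ n) (p : unitInterval)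
    (𝓕 : RGraphFamily r) (A : Set (RGraph r (Fin n))) (lam : ℝ≥0∞) (hlam : lam ≤ 1) (η : ℝ)
    (hA : ∀ G ∈ A, ((𝓕.badSets G m).card : ℝ) ≤ η * n.choose m) :
    gnp r n p A * lam ^ (η * (n.choose r / m.choose r)) ≤
      (gnp r m p (𝓕.forb m) + lam) ^ ((n.choose r : ℝ) / m.choose r) := by
  classical
  have hB : (0 : ℝ) < m.choose r := by exact_mod_cast Nat.choose_pos hrm
  have hd : (0 : ℝ) < (n - r).choose (m - r) := by
    exact_mod_cast Nat.choose_pos (Nat.sub_le_sub_right hmn r)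
  have hMd : (n.choose m : ℝ) * (1 / (n - r).choose (m - r)) = n.choose r / m.choose r := by
    have : (n.choose m : ℝ) * m.choose r = n.choose r * (n - r).choose (m - r) := by
      exact_mod_cast Nat.choose_mul hrm
    field_simp
    linarith
  -- Each `r`-set lies in `(n - r).choose (m - r)` of the `m`-sets, so these weights sum to 1 over
  -- it.
  set w : ℝ := 1 / (n - r).choose (m - r) with hw
  have hw0 : 0 ≤ w := by positivity
  let I : Finset (Finset (Fin n)) := Finset.univ.powersetCard m
  let g : Finset (Fin n) → RGraph r (Fin n) → ℝ≥0∞ := fun S G ↦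
    if 𝓕.IsFreeOn G S then 1 else lam
  have finner : ∫⁻ G, ∏ S ∈ I, g S G ^ w ∂gnp r n p ≤
      ∏ S ∈ I, (∫⁻ G, g S G ∂gnp r n p) ^ w := by
    refine lintegral_setBernoulli_prod_rpow_le p I
      (fun S ↦ {e : {e : Finset (Fin n) // e.card = r} | e.1 ⊆ S}) (fun _ ↦ w) (fun _ ↦ hw0) g
      (fun S G H h ↦ ?_) fun e ↦ ?_
    · have := 𝓕.isFreeOn_congr (G := G) (H := H) (S := S) fun e he ↦ h e (by simpa using he)
      simp only [g, this]
    · have : (I.filter fun S ↦ e.1 ⊆ S).card = (n - r).choose (m - r) := by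
        rw [Finset.card_filter_powersetCard_subset _ _ _ (Finset.subset_univ _)
          (by rw [e.2]; exact hrm), e.2]
        simp
      simp only [Finset.mem_filter, Finset.mem_univ, true_and, Finset.sum_const, this, nsmul_eq_mul,
        hw]
      field_simp
  calc gnp r n p A * lam ^ (η * (n.choose r / m.choose r))
      = ∫⁻ G, A.indicator (fun _ ↦ lam ^ (η * (n.choose r / m.choose r))) G ∂gnp r n p := by
        rw [lintegral_indicator_const .of_discrete, mul_comm]
    _ ≤ ∫⁻ G, ∏ S ∈ I, g S G ^ w ∂gnp r n p := by
        refine lintegral_mono fun G ↦ ?_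
        by_cases hG : G ∈ A
        · have : ∏ S ∈ I, g S G ^ w = lam ^ (w * (𝓕.badSets G m).card) := by
            rw [ENNReal.rpow_mul, ENNReal.rpow_natCast, ← Finset.prod_const,
              RGraphFamily.badSets, Finset.prod_filter]
            refine Finset.prod_congr rfl fun S _ ↦ ?_
            by_cases h : 𝓕.IsFreeOn G S <;> simp [g, h]
          rw [Set.indicator_of_mem hG, this]
          refine ENNReal.rpow_le_rpow_of_exponent_ge hlam ?_
          calc w * (𝓕.badSets G m).card ≤ w * (η * n.choose m) := by gcongr; exact hA G hG
            _ = η * (n.choose r / m.choose r) := by rw [← hMd]; ring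
        · simp [hG]
    _ ≤ ∏ S ∈ I, (∫⁻ G, g S G ∂gnp r n p) ^ w := finner
    _ ≤ ∏ S ∈ I, (gnp r m p (𝓕.forb m) + lam) ^ w := by
        gcongr with S hS
        exact lintegral_isFreeOn_le p 𝓕 (Finset.mem_powersetCard.1 hS).2 lam
    _ = (gnp r m p (𝓕.forb m) + lam) ^ ((n.choose r : ℝ) / m.choose r) := by
        rw [Finset.prod_const, ← ENNReal.rpow_natCast, ← ENNReal.rpow_mul, ← hMd]
        simp [I, mul_comm]

theorem gnp_forb_le_rpow {r m n : ℕ} (hrm : r ≤ m) (hmn : m ≤ n) (p : unitInterval)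
    (𝓕 : RGraphFamily r) :
    gnp r n p (𝓕.forb n) ≤ gnp r m p (𝓕.forb m) ^ ((n.choose r : ℝ) / m.choose r) := by
  -- With `lam = η = 0` the factor on the left is `0 ^ 0 = 1`.
  simpa using gnp_mul_rpow_le hrm hmn p 𝓕 (𝓕.forb n) 0 zero_le_one 0 fun G hG ↦ by
    simp [𝓕.badSets_eq_empty hG]

/-! ### Counting bad `m`-sets. -/

/-- The constant is free of `t`, which is what lets one `δ` serve every `t`. -/
theorem pow_mul_choose_le {m n t : ℕ} (htm : t ≤ m) (hmn : 2 * m ≤ n) :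
    n ^ t * (n - t).choose (m - t) ≤ m.factorial * 4 ^ m * n.choose m := by
  calc n ^ t * (n - t).choose (m - t)
      -- Since `t ≤ m ≤ n / 2`, also `n ≤ 2 * (n + 1 - t)`.
      ≤ (2 * (n + 1 - t)) ^ t * (n - t).choose (m - t) := by gcongr; omega
    _ = 2 ^ t * (n + 1 - t) ^ t * (n - t).choose (m - t) := by rw [mul_pow]
    _ ≤ 2 ^ t * (t.factorial * n.choose t) * (n - t).choose (m - t) := by
        gcongr
        rw [← Nat.descFactorial_eq_factorial_mul_choose]
        exact n.pow_sub_le_descFactorial t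
    _ = t.factorial * (2 ^ t * m.choose t) * n.choose m := by
        have := Nat.choose_mul (n := n) htm
        linear_combination (2 ^ t * t.factorial) * this.symm
    _ ≤ m.factorial * (2 ^ m * 2 ^ m) * n.choose m := by
        gcongr
        · norm_num
        · exact Nat.choose_le_two_pow m t
    _ = m.factorial * 4 ^ m * n.choose m := by rw [← mul_pow]; norm_num

namespace RGraphFamily

variable {r : ℕ} (𝓕 : RGraphFamily r)

theorem le_card_of_contains_induce {V : Type*} {t : ℕ} (ht : ∀ F ∈ 𝓕, t ≤ F.1) {G : RGraph r V}
    {D : Finset V} (h : 𝓕.Contains (G.induce D)) : t ≤ D.card := by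
  obtain ⟨F, hF, σ, -⟩ := h
  simpa using (ht F hF).trans_eq (by simpa using Fintype.card_congr σ)

theorem card_badSets_mul_pow_le {m n t : ℕ} (ht : ∀ F ∈ 𝓕, t ≤ F.1) (hmn : 2 * m ≤ n)
    (G : RGraph r (Fin n)) :
    (𝓕.badSets G m).card * n ^ t ≤
      𝓕.inducedCount G * (m.factorial * 4 ^ m * n.choose m) := by
  classical
  let C : Finset (Finset (Fin n)) := {D | 𝓕.Contains (G.induce D)}
  have hC : 𝓕.inducedCount G = C.card := by
    rw [inducedCount, ← Set.ncard_coe_finset]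
    congr
    ext
    simp [C]
  have hsub : 𝓕.badSets G m ⊆
      C.biUnion fun D ↦ {S ∈ Finset.univ.powersetCard m | D ⊆ S} := by
    intro S hS
    obtain ⟨hSm, hS⟩ := Finset.mem_filter.1 hS
    simp only [IsFreeOn, not_forall, not_not] at hS
    obtain ⟨D, hDS, hD⟩ := hS
    exact Finset.mem_biUnion.2 ⟨D, by simpa [C] using hD, Finset.mem_filter.2 ⟨hSm, hDS⟩⟩
  have hcard : ∀ D ∈ C, ({S ∈ Finset.univ.powersetCard m | D ⊆ S} : Finset _).card * n ^ t ≤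
      m.factorial * 4 ^ m * n.choose m := by
    intro D hD
    have htD := 𝓕.le_card_of_contains_induce ht (Finset.mem_filter.1 hD).2
    rcases lt_or_ge m t with hmt | htm
    -- An `m`-set is too small to contain `D`.
    · rw [Finset.filter_false_of_mem]
      · simp
      · intro S hS hDS
        have := Finset.card_le_card hDS
        rw [(Finset.mem_powersetCard.1 hS).2] at this
        omega
    -- Passing to a `t`-subset of `D` can only increase the number of `m`-sets above it.
    · obtain ⟨D', hD', hD'c⟩ := Finset.exists_subset_card_eq htD
      refine le_trans ?_ (pow_mul_choose_le htm hmn)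
      rw [mul_comm]
      gcongr
      refine (Finset.card_le_card (Finset.monotone_filter_right _
        fun S _ hS ↦ hD'.trans hS)).trans_eq ?_
      rw [Finset.card_filter_powersetCard_subset _ _ _ (Finset.subset_univ _)
        (by rw [hD'c]; exact htm), hD'c]
      simp
  calc (𝓕.badSets G m).card * n ^ t
      ≤ (∑ D ∈ C, ({S ∈ Finset.univ.powersetCard m | D ⊆ S} : Finset _).card) * n ^ t := by
        gcongr
        exact (Finset.card_le_card hsub).trans Finset.card_biUnion_le
    _ = ∑ D ∈ C, ({S ∈ Finset.univ.powersetCard m | D ⊆ S} : Finset _).card * n ^ t :=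
        Finset.sum_mul _ _ _
    _ ≤ ∑ _D ∈ C, m.factorial * 4 ^ m * n.choose m := Finset.sum_le_sum hcard
    _ = 𝓕.inducedCount G * (m.factorial * 4 ^ m * n.choose m) := by simp [hC]

/-- Few induced subgraphs in `𝓕` force a small proportion of `m`-sets that are not `𝓕`-free. -/
theorem card_badSets_le_of_inducedCount_lt {m n t : ℕ} (ht : ∀ F ∈ 𝓕, t ≤ F.1)
    (hmn : 2 * m < n) (G : RGraph r (Fin n)) {η : ℝ}
    (h : (𝓕.inducedCount G : ℝ) < η / (m.factorial * 4 ^ m) * (n : ℝ) ^ t) :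
    ((𝓕.badSets G m).card : ℝ) ≤ η * n.choose m := by
  have hn : (0 : ℝ) < (n : ℝ) ^ t := by
    have : 0 < n := by omega
    positivity
  have hK : (0 : ℝ) < m.factorial * 4 ^ m := by positivity
  have key : ((𝓕.badSets G m).card : ℝ) * (n : ℝ) ^ t ≤
      𝓕.inducedCount G * (m.factorial * 4 ^ m * n.choose m) := by
    exact_mod_cast 𝓕.card_badSets_mul_pow_le ht hmn.le G
  refine le_of_mul_le_mul_right (key.trans ?_) hn
  calc (𝓕.inducedCount G : ℝ) * (m.factorial * 4 ^ m * n.choose m)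
      ≤ η / (m.factorial * 4 ^ m) * (n : ℝ) ^ t * (m.factorial * 4 ^ m * n.choose m) := by gcongr
    _ = η * n.choose m * (n : ℝ) ^ t := by field_simp

theorem badSets_eq_of_forb_eq_empty {m n : ℕ} (h : 𝓕.forb m = ∅) (G : RGraph r (Fin n)) :
    𝓕.badSets G m = Finset.univ.powersetCard m := by
  classical
  refine Finset.filter_true_of_mem fun S hS hfree ↦ ?_
  obtain ⟨f, rfl⟩ := exists_embedding_map_univ_eq (Finset.mem_powersetCard.1 hS).2
  exact Set.notMem_empty _ (h ▸ (𝓕.isFreeOn_map_univ_iff f G).1 hfree)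

end RGraphFamily

/-! ### Monotonicity and convergence of the exponents. -/

theorem twoPow_strictMono : StrictMono twoPow := by
  have hl : (0 : ℝ) < Real.log 2 := Real.log_pos (by norm_num)
  intro x y hxy
  refine EReal.expOrderIso.strictMono ?_
  by_contra! h
  have h' := EReal.div_le_div_right_of_nonneg (c := (Real.log 2 : ℝ)) (by exact_mod_cast hl.le) h
  have hne : ((Real.log 2 : ℝ) : EReal) ≠ 0 := by exact_mod_cast hl.ne'
  rw [← EReal.mul_div_right, ← EReal.mul_div_right,
    EReal.div_mul_cancel (EReal.coe_ne_bot _) (EReal.coe_ne_top _) hne,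
    EReal.div_mul_cancel (EReal.coe_ne_bot _) (EReal.coe_ne_top _) hne] at h'
  exact absurd hxy h'.not_gt

theorem twoPow_mul_coe (x : EReal) (y : ℝ) : twoPow (x * y) = twoPow x ^ y := by
  rw [twoPow, twoPow, ← EReal.exp_mul, mul_right_comm]

theorem twoPow_neg_mul_le_iff {x y : EReal} {b : ℕ} (hb : 0 < b) :
    twoPow (-x * b) ≤ twoPow (-y * b) ↔ y ≤ x := by
  have hne : (b : EReal) ≠ 0 := by exact_mod_cast hb.ne'
  rw [twoPow_strictMono.le_iff_le]
  refine ⟨fun h ↦ ?_, fun h ↦ ?_⟩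
  · have h' := EReal.div_le_div_right_of_nonneg (c := b) (by positivity) h
    rwa [← EReal.mul_div_right, ← EReal.mul_div_right,
      EReal.div_mul_cancel (EReal.natCast_ne_bot _) (EReal.natCast_ne_top _) hne,
      EReal.div_mul_cancel (EReal.natCast_ne_bot _) (EReal.natCast_ne_top _) hne,
      EReal.neg_le_neg_iff] at h'
  · exact mul_le_mul_of_nonneg_right (EReal.neg_le_neg_iff.2 h) (by positivity)

section Exponent

variable {r : ℕ} (p : unitInterval) (𝓕 : RGraphFamily r)

theorem hereditaryExponent_mono {m n : ℕ} (hrm : r ≤ m) (hmn : m ≤ n) :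
    hereditaryExponent p 𝓕 m ≤ hereditaryExponent p 𝓕 n := by
  rw [← twoPow_neg_mul_le_iff (Nat.choose_pos (hrm.trans hmn)),
    ← gnp_forb_eq_twoPow p 𝓕 (hrm.trans hmn)]
  refine (gnp_forb_le_rpow hrm hmn p 𝓕).trans_eq ?_
  have hB : (m.choose r : ℝ) ≠ 0 := by exact_mod_cast (Nat.choose_pos hrm).ne'
  rw [gnp_forb_eq_twoPow p 𝓕 hrm, ← twoPow_mul_coe, mul_assoc, ← EReal.coe_natCast,
    ← EReal.coe_mul, mul_div_cancel₀ _ hB, EReal.coe_natCast]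

theorem hereditaryExponent_nonneg {m : ℕ} (hrm : r ≤ m) : 0 ≤ hereditaryExponent p 𝓕 m := by
  rw [← twoPow_neg_mul_le_iff (Nat.choose_pos hrm), ← gnp_forb_eq_twoPow p 𝓕 hrm]
  simpa [twoPow] using prob_le_one

theorem tendsto_hereditaryExponent :
    Tendsto (hereditaryExponent p 𝓕) atTop (𝓝 (limitExponent p 𝓕)) := by
  -- The shift by `r` skips the indices where `n.choose r = 0`.
  have hmono : Monotone fun n ↦ hereditaryExponent p 𝓕 (n + r) := fun a b h ↦
    hereditaryExponent_mono p 𝓕 (Nat.le_add_left _ _) (Nat.add_le_add_right h _)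
  have := (tendsto_add_atTop_iff_nat r).1 (tendsto_atTop_iSup hmono)
  rwa [limitExponent, this.limUnder_eq]

theorem hereditaryExponent_le_limitExponent {m : ℕ} (hrm : r ≤ m) :
    hereditaryExponent p 𝓕 m ≤ limitExponent p 𝓕 :=
  ge_of_tendsto (tendsto_hereditaryExponent p 𝓕) <| (eventually_ge_atTop m).mono fun _ h ↦
    hereditaryExponent_mono p 𝓕 hrm h

end Exponent

/-! ### Infinite limit exponent. -/

theorem exists_pow_le_gnp_singleton (r : ℕ) (p : unitInterval) (hp0 : 0 < p) (hp1 : p < 1) :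
    ∃ q : ℝ, 0 < q ∧ ∀ (n : ℕ) (G : RGraph r (Fin n)),
      ENNReal.ofReal q ^ n.choose r ≤ gnp r n p {G} := by
  have h0 : (0 : ℝ) < p := hp0
  have h1 : (p : ℝ) < 1 := hp1
  refine ⟨min p (1 - p), lt_min h0 (by linarith), fun n G ↦ ?_⟩
  rw [gnp, setBernoulli_singleton _ (Set.subset_univ _) Set.finite_univ]
  have hcard : n.choose r = G.ncard + (Set.univ \ G).ncard := by
    rw [← Set.compl_eq_univ_sdiff, Set.ncard_add_ncard_compl]
    simp [Nat.card_eq_fintype_card]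
  rw [hcard, pow_add]
  gcongr
  · rw [ENNReal.ofReal_le_iff_le_toReal (by simp)]
    exact min_le_left _ _
  · rw [ENNReal.ofReal_le_iff_le_toReal (by simp)]
    exact min_le_right _ _

/-- If the limit exponent is infinite, then `𝓕`-free graphs of some size do not exist. -/
theorem exists_forb_eq_empty {r : ℕ} (p : unitInterval) (hp0 : 0 < p) (hp1 : p < 1)
    (𝓕 : RGraphFamily r) (h : limitExponent p 𝓕 = ⊤) : ∃ m, r ≤ m ∧ 𝓕.forb m = ∅ := by
  by_contra! hne
  obtain ⟨q, hq0, hq⟩ := exists_pow_le_gnp_singleton r p hp0 hp1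
  -- A single free graph already has probability at least `q ^ (m.choose r)`, which bounds `c_m`
  -- uniformly.
  have hbound : ∀ m, r ≤ m → hereditaryExponent p 𝓕 m ≤ ((-Real.logb 2 q : ℝ) : EReal) := by
    intro m hm
    obtain ⟨G, hG⟩ := hne m hm
    rw [← twoPow_neg_mul_le_iff (Nat.choose_pos hm), ← gnp_forb_eq_twoPow p 𝓕 hm,
      ← EReal.coe_natCast, twoPow_mul_coe, ENNReal.rpow_natCast, ← EReal.coe_neg, neg_neg,
      twoPow_coe, Real.rpow_logb (by norm_num) (by norm_num) hq0]
    exact (hq m G).trans (measure_mono (Set.singleton_subset_iff.2 hG))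
  have := le_of_tendsto (tendsto_hereditaryExponent p 𝓕)
    ((eventually_ge_atTop r).mono fun m hm ↦ hbound m hm)
  rw [h] at this
  exact absurd this (EReal.coe_lt_top _).not_ge

/-! ### Finite limit exponent. -/

theorem exists_add_le_mul_rpow {a s : ℝ} (ha : 0 < a) (hs : 0 < s) :
    ∃ lam η : ℝ, 0 < lam ∧ lam ≤ 1 ∧ 0 < η ∧ a + lam ≤ a * 2 ^ s * lam ^ η := by
  have h2 : (1 : ℝ) < 2 ^ (s / 2) := Real.one_lt_rpow (by norm_num) (by linarith)
  -- One factor `2 ^ (s / 2)` absorbs the addition of `lam`; the other absorbs `lam ^ η`, which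
  -- tends to 1 as `η → 0`.
  let lam := min 1 (a * (2 ^ (s / 2) - 1))
  have hlam : 0 < lam := lt_min one_pos (mul_pos ha (by linarith))
  have hcont : Tendsto (fun η : ℝ ↦ 2 ^ (s / 2) * lam ^ η) (𝓝 0)
      (𝓝 (2 ^ (s / 2) * lam ^ (0 : ℝ))) :=
    (Real.continuousAt_const_rpow hlam.ne').tendsto.const_mul _
  rw [Real.rpow_zero, mul_one] at hcont
  obtain ⟨η, hη, hη0⟩ := ((hcont.eventually (lt_mem_nhds h2)).filter_mono
    nhdsWithin_le_nhds |>.and (self_mem_nhdsWithin (s := Set.Ioi (0 : ℝ)))).exists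
  refine ⟨lam, η, hlam, min_le_left _ _, hη0, ?_⟩
  have hss : (2 : ℝ) ^ s = 2 ^ (s / 2) * 2 ^ (s / 2) := by
    rw [← Real.rpow_add (by norm_num)]
    ring_nf
  calc a + lam ≤ a + a * (2 ^ (s / 2) - 1) := by gcongr; exact min_le_right _ _
    _ = a * 2 ^ (s / 2) * 1 := by ring
    _ ≤ a * 2 ^ (s / 2) * (2 ^ (s / 2) * lam ^ η) := by gcongr
    _ = a * 2 ^ s * lam ^ η := by rw [hss]; ring

/-- If the limit exponent is finite, then graphs that are `𝓕`-free on all but a small proportion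
of the `m`-sets, for a suitable `m`, are about as unlikely as `𝓕`-free graphs. -/
theorem exists_gnp_le_of_card_badSets_le {r : ℕ} (p : unitInterval) (𝓕 : RGraphFamily r) {l : ℝ}
    (hl : limitExponent p 𝓕 = l) {ε : ℝ} (hε : 0 < ε) :
    ∃ m : ℕ, ∃ η : ℝ, 0 < η ∧ ∀ n, m ≤ n → ∀ A : Set (RGraph r (Fin n)),
      (∀ G ∈ A, ((𝓕.badSets G m).card : ℝ) ≤ η * n.choose m) →
        gnp r n p A ≤ ENNReal.ofReal (2 ^ ((-l + ε) * n.choose r)) := by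
  -- Half of `ε` pays for replacing `c` by `c_m`, the other half for `lam` and `η`.
  have hlt : ((l - ε / 2 : ℝ) : EReal) < limitExponent p 𝓕 := by
    rw [hl]
    exact_mod_cast (by linarith : l - ε / 2 < l)
  obtain ⟨m, hcm, hrm⟩ := (((tendsto_hereditaryExponent p 𝓕).eventually (lt_mem_nhds hlt)).and
    (eventually_ge_atTop r)).exists
  have hle := hl ▸ hereditaryExponent_le_limitExponent p 𝓕 hrm
  obtain ⟨c, hc⟩ : ∃ c : ℝ, (c : EReal) = hereditaryExponent p 𝓕 m :=
    ⟨_, EReal.coe_toReal (hle.trans_lt (EReal.coe_lt_top _)).ne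
      ((EReal.bot_lt_coe _).trans hcm).ne'⟩
  rw [← hc, EReal.coe_lt_coe_iff] at hcm
  have hB : (0 : ℝ) < m.choose r := by exact_mod_cast Nat.choose_pos hrm
  have hP : gnp r m p (𝓕.forb m) = ENNReal.ofReal (2 ^ (-c * m.choose r)) := by
    rw [gnp_forb_eq_twoPow p 𝓕 hrm, ← hc, ← twoPow_coe]
    push_cast
    rfl
  set a : ℝ := 2 ^ (-c * m.choose r) with ha
  have ha0 : 0 < a := by positivity
  obtain ⟨lam, η, hlam0, hlam1, hη, hmain⟩ :=
    exists_add_le_mul_rpow ha0 (s := m.choose r * (ε / 2)) (by positivity)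
  refine ⟨m, η, hη, fun n hmn A hA ↦ ?_⟩
  have key := gnp_mul_rpow_le hrm hmn p 𝓕 A (ENNReal.ofReal lam)
    (by simpa using hlam1) η hA
  set x : ℝ := n.choose r / m.choose r with hx
  have hx0 : 0 ≤ x := by positivity
  rw [hP, ← ENNReal.ofReal_add ha0.le hlam0.le, ENNReal.ofReal_rpow_of_pos hlam0,
    ENNReal.ofReal_rpow_of_pos (by positivity)] at key
  have hpos : 0 < lam ^ (η * x) := by positivity
  have hreal : (a + lam) ^ x ≤ 2 ^ ((-l + ε) * n.choose r) * lam ^ (η * x) := by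
    calc (a + lam) ^ x ≤ (a * 2 ^ (m.choose r * (ε / 2)) * lam ^ η) ^ x := by gcongr
      _ = 2 ^ ((-c + ε / 2) * n.choose r) * lam ^ (η * x) := by
        rw [Real.mul_rpow (by positivity) (by positivity), ← Real.rpow_mul hlam0.le, ha,
          ← Real.rpow_add (by norm_num), ← Real.rpow_mul (by norm_num)]
        congr 2
        rw [hx]
        field_simp
      _ ≤ 2 ^ ((-l + ε) * n.choose r) * lam ^ (η * x) := by
        have : -c + ε / 2 ≤ -l + ε := by linarith
        gcongr 2 ^ (?_ * _) * _
        norm_num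
  have := key.trans (ENNReal.ofReal_le_ofReal hreal)
  rw [ENNReal.ofReal_mul (by positivity)] at this
  exact (ENNReal.mul_le_mul_iff_left (by simpa using hpos) ENNReal.ofReal_ne_top).1 this

/-! ### Supersaturation. -/

/-- Supersaturation, in the form in which the collection of graphs is determined by having few
induced subgraphs in `𝓕`. -/
theorem exists_gnp_le_of_inducedCount_lt {r : ℕ} (p : unitInterval) (hp0 : 0 < p) (hp1 : p < 1)
    (𝓕 : RGraphFamily r) {ε : ℝ} (hε : 0 < ε) :
    ∃ n₀ : ℕ, ∃ δ : ℝ, 0 < δ ∧ ∀ t : ℕ, (∀ F ∈ 𝓕, t ≤ F.1) → ∀ n : ℕ, n₀ < n →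
      ∀ A : Set (RGraph r (Fin n)), (∀ G ∈ A, (𝓕.inducedCount G : ℝ) < δ * (n : ℝ) ^ t) →
        gnp r n p A ≤ twoPow ((-limitExponent p 𝓕 + (ε : EReal)) * ((n.choose r : ℕ) : EReal)) := by
  induction hl : limitExponent p 𝓕 with
  | bot =>
    have := hereditaryExponent_nonneg p 𝓕 le_rfl |>.trans
      (hereditaryExponent_le_limitExponent p 𝓕 le_rfl)
    rw [hl] at this
    exact absurd this EReal.bot_lt_zero.not_ge
  | coe l =>
    obtain ⟨m, η, hη, h⟩ := exists_gnp_le_of_card_badSets_le p 𝓕 hl hε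
    refine ⟨2 * m, η / (m.factorial * 4 ^ m), by positivity, fun t ht n hn A hA ↦ ?_⟩
    have := h n (by omega) A fun G hG ↦
      𝓕.card_badSets_le_of_inducedCount_lt ht hn G (hA G hG)
    rw [← twoPow_coe] at this
    exact_mod_cast this
  | top =>
    obtain ⟨m, -, hm⟩ := exists_forb_eq_empty p hp0 hp1 𝓕 hl
    -- Here `η = 1 / 2`; any `η < 1` contradicts all `m`-sets being bad, so `A` is empty.
    refine ⟨2 * m, (1 / 2) / (m.factorial * 4 ^ m), by positivity, fun t ht n hn A hA ↦ ?_⟩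
    have : A = ∅ := by
      refine Set.eq_empty_of_forall_notMem fun G hG ↦ ?_
      have h := 𝓕.card_badSets_le_of_inducedCount_lt ht hn G (hA G hG)
      rw [𝓕.badSets_eq_of_forb_eq_empty hm] at h
      have hpos : (0 : ℝ) < n.choose m := by exact_mod_cast Nat.choose_pos (by omega)
      simp at h
      linarith
    simp [this]

theorem mainTheorem1 (r : ℕ) (𝓕 : RGraphFamily r) (p : unitInterval) (hp0 : 0 < p) (hp1 : p < 1) :
    Tendsto (hereditaryExponent p 𝓕) atTop (𝓝 (limitExponent p 𝓕)) ∧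
    ∀ ε : ℝ, 0 < ε → ∃ n₀ : ℕ, ∃ δ : ℝ, 0 < δ ∧
      ∀ t : ℕ, (∀ F ∈ 𝓕, t ≤ F.1) → ∀ n : ℕ, n₀ < n →
        (∀ 𝒜 : Set (RGraph r (Fin n)),
          twoPow ((-limitExponent p 𝓕 + (ε : EReal)) * ((n.choose r : ℕ) : EReal))
              < gnp r n p 𝒜 →
            ∃ G ∈ 𝒜, δ * (n : ℝ) ^ t ≤ (𝓕.inducedCount G : ℝ)) ∧
        gnp r n p {G | (𝓕.inducedCount G : ℝ) < δ * (n : ℝ) ^ t}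
          ≤ twoPow ((-limitExponent p 𝓕 + (ε : EReal)) * ((n.choose r : ℕ) : EReal)) := by
  refine ⟨tendsto_hereditaryExponent p 𝓕, fun ε hε ↦ ?_⟩
  obtain ⟨n₀, δ, hδ, h⟩ := exists_gnp_le_of_inducedCount_lt p hp0 hp1 𝓕 hε
  refine ⟨n₀, δ, hδ, fun t ht n hn ↦ ⟨fun 𝒜 h𝒜 ↦ ?_, h t ht n hn _ fun _ hG ↦ hG⟩⟩
  by_contra! hlt
  exact h𝒜.not_ge (h t ht n hn 𝒜 hlt)
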